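/- Let $\mathbb k$ be a field and let $A$ be a $\mathbb k$-algebra. An action of a Hopf algebra $H$ on $A$ is a linear map $\psi\colon H\otimes A\to A$, written $h\otimes a\mapsto ha$, that makes $A$ a left $H$-module and satisfies $h(ab)=(h_{(1)}a)(h_{(2)}b)$; its cosupport is $\operatorname{cosupp}\psi=\{\psi(h\otimes -)\mid h\in H\}\subseteq \operatorname{End}_{\mathbb k}(A)$. A coaction of $H$ on $A$ is a right $H$-comodule structure $\rho\colon A\to A\otimes H$, $\rho(a)=a_{(0)}\otimes a_{(1)}$, with $\rho(ab)=\rho(a)\rho(b)$; its cosupport is $\operatorname{cosupp}\rho=\{a\mapsto \lambda(a_{(1)})a_{(0)}\mid \lambda\in H^*\}\subseteq\operatorname{End}_{\mathbb k}(A)$. Both cosupports are unital subalgebras. For a unital subalgebra $V\subseteq \operatorname{End}_{\mathbb k}(A)$, a $V$-universal acting Hopf algebra is a pair $({}_\square\mathcal H(A,V),\psi^{\mathbf{Hopf}}_{A,V})$ consisting of a Hopf algebra and an action of it on $A$ with $\operatorname{cosupp}\psi^{\mathbf{Hopf}}_{A,V}\subseteq V$ such that for every Hopf algebra $H$ and every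 action $\psi\colon H\otimes A\to A$ with $\operatorname{cosupp}\psi\subseteq V$ there is a unique Hopf algebra homomorphism $\varphi\colon H\to{}_\square\mathcal H(A,V)$ with $\psi=\psi^{\mathbf{Hopf}}_{A,V}(\varphi\otimes \mathrm{id}_A)$. A grading of $A$ by a group $G$ is a direct sum decomposition $\Gamma\colon A=\bigoplus_{g\in G}A^{(g)}$ into subspaces with $A^{(g)}A^{(h)}\subseteq A^{(gh)}$; its support is $\operatorname{supp}\Gamma=\{g\mid A^{(g)}\neq 0\}$, and the corresponding $\mathbb kG$-coaction is $\rho(a)=a\otimes g$ for $a\in A^{(g)}$. A grading $\Gamma'$ of $A$ by a group $G'$ is a realization of $\Gamma$ with embedding $\kappa\colon\operatorname{supp}\Gamma\to G'$ if the component of $\Gamma$ of degree $s$ equals the component of $\Gamma'$ of degree $\kappa(s)$ for all $s\in\operatorname{supp}\Gamma$. A group $G_\Gamma$ together with a realization of $\Gamma$ as a $G_\Gamma$-grading with embedding $\varkappa_\Gamma$ is the universal group of $\Gamma$ if for every realization of $\Gamma$ by a group $G'$ with embedding $\kappa$ there is a unique group homomorphism $\varphi\colon G_\Gamma\to G'$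 with $\varphi\varkappa_\Gamma=\kappa$. A grading of $M_n(\mathbb k)$ by a group $G$ is elementary if there are $g_1,\dots,g_n\in G$ such that every matrix unit $e_{ij}$ is homogeneous of degree $g_ig_j^{-1}$. **Theorem.** Let $\mathbb k$ be an arbitrary field, let $G$ be an infinite finitely presented group that has no nontrivial finite quotients, and let $\Gamma$ be an elementary grading (by some group) on the full matrix algebra $M_n(\mathbb k)$, $n\in\mathbb N$, whose universal group is isomorphic to $G$. Let $\rho\colon M_n(\mathbb k)\to M_n(\mathbb k)\otimes\mathbb kG$ be the coaction corresponding to the realization of $\Gamma$ as a $G$-grading, and let $V:=\operatorname{cosupp}\rho$. Then a $V$-universal acting Hopf algebra exists, and (for any such) $$\operatorname{cosupp}\psi^{\mathbf{Hopf}}_{M_n(\mathbb k),V}=\mathbb k\,\mathrm{id}_{M_n(\mathbb k)}\subsetneqq V=\operatorname{cosupp}\rho.$$ -/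

import Mathlib

open scoped TensorProduct

universe u v v₀ v₁ w a b

noncomputable section

namespace QSym


/-! ### Hopf algebra actions and coactions -/

/-- An `H`-action on a (not necessarily associative or unital) `k`-algebra `A`: a left `H`-module
structure on `A`, recorded as a unital algebra homomorphism `H → End_k A`, such that
`h (x y) = (h₍₁₎ x) (h₍₂₎ y)`. -/
structure HopfAction (k : Type u) [Field k] (H : Type v) [Ring H] [HopfAlgebra k H]
    (A : Type a) [NonUnitalNonAssocRing A] [Module k A] [IsScalarTower k A A]
    [SMulCommClass k A A] where
  /-- the operator `x ↦ h x` -/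
  act : H →ₐ[k] Module.End k A
  act_mul : ∀ (h : H) (x y : A),
    act h (x * y) = LinearMap.mul' k A
      (TensorProduct.map (act.toLinearMap.flip x) (act.toLinearMap.flip y)
        (Coalgebra.comul (R := k) h))

/-- An `H`-coaction on a (not necessarily associative or unital) `k`-algebra `A`: a right
`H`-comodule structure `ρ : A → A ⊗ H` that is multiplicative. -/
structure HopfCoaction (k : Type u) [Field k] (H : Type v) [Ring H] [HopfAlgebra k H]
    (A : Type a) [NonUnitalNonAssocRing A] [Module k A] [IsScalarTower k A A]
    [SMulCommClass k A A] where
  /-- the structure map -/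
  coact : A →ₗ[k] A ⊗[k] H
  coassoc : (TensorProduct.assoc k A H H).toLinearMap ∘ₗ coact.rTensor H ∘ₗ coact =
    (Coalgebra.comul (R := k) (A := H)).lTensor A ∘ₗ coact
  counit : (TensorProduct.rid k A).toLinearMap ∘ₗ
    (Coalgebra.counit (R := k) (A := H)).lTensor A ∘ₗ coact = LinearMap.id
  map_mul : ∀ x y : A, coact (x * y) = coact x * coact y

section

variable {k : Type u} [Field k] {H : Type v} [Ring H] [HopfAlgebra k H]
  {A : Type a} [NonUnitalNonAssocRing A] [Module k A] [IsScalarTower k A A] [SMulCommClass k A A]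

/-- The cosupport of an action: the unital subalgebra of all operators `x ↦ h x`, `h ∈ H`. -/
def HopfAction.cosupp (ψ : HopfAction k H A) : Subalgebra k (Module.End k A) :=
  ψ.act.range

/-- For `f : A → A ⊗ H` and a linear function `l` on `H`, the operator
`x ↦ ∑ l (h_i) x_i` where `f x = ∑ x_i ⊗ h_i`. -/
def dualOp (f : A →ₗ[k] A ⊗[k] H) (l : Module.Dual k H) : Module.End k A :=
  (TensorProduct.rid k A).toLinearMap ∘ₗ l.lTensor A ∘ₗ f

theorem HopfCoaction.dualOp_mul (ρ : HopfCoaction k H A) (l m : Module.Dual k H) :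
    dualOp ρ.coact l * dualOp ρ.coact m =
      dualOp ρ.coact (LinearMap.mul' k k ∘ₗ TensorProduct.map l m ∘ₗ Coalgebra.comul) := by
  ext x
  have h1 := LinearMap.congr_fun ρ.coassoc x
  simp only [LinearMap.comp_apply, LinearEquiv.coe_coe] at h1
  have h2 : dualOp ρ.coact (LinearMap.mul' k k ∘ₗ TensorProduct.map l m ∘ₗ Coalgebra.comul) x
      = TensorProduct.rid k A ((LinearMap.mul' k k ∘ₗ TensorProduct.map l m).lTensor A
        ((Coalgebra.comul (R := k) (A := H)).lTensor A (ρ.coact x))) := by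
    rw [← LinearMap.comp_apply (LinearMap.lTensor A _), ← LinearMap.lTensor_comp]
    rfl
  rw [h2, ← h1]
  change dualOp ρ.coact l (TensorProduct.rid k A (m.lTensor A (ρ.coact x))) = _
  generalize ρ.coact x = t
  induction t with
  | zero => simp
  | add s t hs ht => simp only [map_add, hs, ht]
  | tmul y h =>
    simp only [LinearMap.lTensor_tmul, TensorProduct.rid_tmul, map_smul, LinearMap.rTensor_tmul]
    change m h • TensorProduct.rid k A (l.lTensor A (ρ.coact y)) = _
    generalize ρ.coact y = t
    induction t with
    | zero => simp
    | add s t hs ht => simp only [map_add, smul_add, hs, ht, TensorProduct.add_tmul]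
    | tmul z h' => simp [smul_smul, mul_comm]

/-- The cosupport of a coaction `ρ`: the unital subalgebra of all operators
`x ↦ l (x₍₁₎) x₍₀₎`, `l ∈ H^*`. -/
def HopfCoaction.cosupp (ρ : HopfCoaction k H A) : Subalgebra k (Module.End k A) where
  carrier := {f | ∃ l : Module.Dual k H, dualOp ρ.coact l = f}
  mul_mem' := by
    rintro _ _ ⟨l, rfl⟩ ⟨m, rfl⟩
    exact ⟨_, (ρ.dualOp_mul l m).symm⟩
  add_mem' := by
    rintro _ _ ⟨l, rfl⟩ ⟨m, rfl⟩
    exact ⟨l + m, by ext x; simp [dualOp, LinearMap.lTensor_add]⟩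
  algebraMap_mem' := fun c => by
    refine ⟨c • Coalgebra.counit, ?_⟩
    have h := ρ.counit
    ext x
    have hx := LinearMap.congr_fun h x
    simp only [LinearMap.comp_apply, LinearEquiv.coe_coe, LinearMap.id_apply] at hx
    simp [dualOp, LinearMap.lTensor_smul, hx, Module.algebraMap_end_apply]

/-- `(H, ψ)` is a `V`-universal acting Hopf algebra: `cosupp ψ ⊆ V`, and every action `ψ'` of a
Hopf algebra `H'` with `cosupp ψ' ⊆ V` factors through `ψ` by a unique homomorphism of Hopf
algebras `H' → H`. (A bialgebra homomorphism of Hopf algebras preserves antipodes.)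
The algebras `H'` range over the universe `w`. -/
def HopfAction.IsUniversal (V : Subalgebra k (Module.End k A)) (ψ : HopfAction k H A) : Prop :=
  ψ.cosupp ≤ V ∧
    ∀ (H' : Type w) [Ring H'] [HopfAlgebra k H'] (ψ' : HopfAction k H' A), ψ'.cosupp ≤ V →
      ∃! φ : H' →ₐc[k] H, ∀ (h : H') (x : A), ψ.act (φ h) x = ψ'.act h x

end

/-! ### Group gradings -/

/-- A grading `A = ⨁_{g ∈ G} A^(g)` of a `k`-algebra by a group `G`. -/
structure GroupGrading (k : Type u) [Field k] (A : Type a) [NonUnitalNonAssocRing A] [Module k A]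
    (G : Type v) [Group G] where
  /-- the graded component `A^(g)` -/
  component : G → Submodule k A
  indep : iSupIndep component
  iSup_eq_top : ⨆ g, component g = ⊤
  mul_mem : ∀ {g h : G} {x y : A}, x ∈ component g → y ∈ component h →
    x * y ∈ component (g * h)

namespace GroupGrading

variable {k : Type u} [Field k] {A : Type a} [NonUnitalNonAssocRing A] [Module k A]
  {G : Type v} [Group G]

/-- The support `{g | A^(g) ≠ 0}`. -/
def supp (Γ : GroupGrading k A G) : Set G := {g | Γ.component g ≠ ⊥}

/-- `Γ` is realized as the `G'`-grading `Γ'` of the same algebra, and `ψ : supp Γ → G'` is the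
corresponding relabelling of the graded components. -/
def IsRealizedBy (Γ : GroupGrading k A G) {G' : Type b} [Group G'] (Γ' : GroupGrading k A G')
    (ψ : Γ.supp → G') : Prop :=
  ∀ s : Γ.supp, Γ.component s = Γ'.component (ψ s)

/-- `(U, κ)` is the universal group of `Γ`, where `ΓU` is the realization of `Γ` as a `U`-grading
and `κ : supp Γ → U` the corresponding embedding: for each realization of `Γ` by a group `G'`
with embedding `ψ` there is a unique homomorphism `φ : U → G'` with `φ ∘ κ = ψ`. -/
def IsUniversalGroup (Γ : GroupGrading k A G) {U : Type b} [Group U] (ΓU : GroupGrading k A U)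
    (κ : Γ.supp → U) : Prop :=
  Γ.IsRealizedBy ΓU κ ∧
    ∀ (G' : Type b) [Group G'] (Γ' : GroupGrading k A G') (ψ : Γ.supp → G'),
      Γ.IsRealizedBy Γ' ψ → ∃! φ : U →* G', ∀ s, φ (κ s) = ψ s

/-- A grading of `M_n(k)` is elementary if there are `g_1, …, g_n ∈ G` such that each matrix unit
`e_ij` has degree `g_i g_j⁻¹`. -/
def IsElementary {n : ℕ} (Γ : GroupGrading k (Matrix (Fin n) (Fin n) k) G) : Prop :=
  ∃ g : Fin n → G, ∀ i j, Matrix.single i j (1 : k) ∈ Γ.component (g i * (g j)⁻¹)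

theorem bijective_coeLinearMap [DecidableEq G] (Γ : GroupGrading k A G) :
    Function.Bijective (DirectSum.coeLinearMap Γ.component) :=
  (DirectSum.isInternal_submodule_iff_iSupIndep_and_iSup_eq_top Γ.component).2
    ⟨Γ.indep, Γ.iSup_eq_top⟩

open Classical in
/-- The linear map `A → A ⊗ kG` with `x ↦ x ⊗ g` for all `x ∈ A^(g)`, `g ∈ G`. -/
def coactionMap (Γ : GroupGrading k A G) : A →ₗ[k] A ⊗[k] MonoidAlgebra k G :=
  DirectSum.toModule k G (A ⊗[k] MonoidAlgebra k G)
      (fun g => (TensorProduct.mk k A (MonoidAlgebra k G)).flip (MonoidAlgebra.single g 1) ∘ₗ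
        (Γ.component g).subtype) ∘ₗ
    (LinearEquiv.ofBijective (DirectSum.coeLinearMap Γ.component)
      Γ.bijective_coeLinearMap).symm.toLinearMap

theorem coactionMap_of_mem (Γ : GroupGrading k A G) {g : G} {x : A} (hx : x ∈ Γ.component g) :
    Γ.coactionMap x = x ⊗ₜ[k] MonoidAlgebra.single g (1 : k) := by
  classical
  have h : (LinearEquiv.ofBijective (DirectSum.coeLinearMap Γ.component)
      Γ.bijective_coeLinearMap).symm x = DirectSum.lof k G (fun g => Γ.component g) g ⟨x, hx⟩ := by
    rw [LinearEquiv.symm_apply_eq]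
    simp
  simp only [coactionMap, LinearMap.comp_apply, LinearEquiv.coe_coe]
  convert congrArg _ h using 1
  simp

theorem linearMap_ext (Γ : GroupGrading k A G) {M : Type b} [AddCommGroup M] [Module k M]
    {f f' : A →ₗ[k] M} (h : ∀ g, ∀ x ∈ Γ.component g, f x = f' x) : f = f' := by
  have : (⊤ : Submodule k A) ≤ LinearMap.eqLocus f f' := by
    rw [← Γ.iSup_eq_top]
    exact iSup_le fun g x hx => h g x hx
  ext x
  exact this (Submodule.mem_top (x := x))

/-- The `kG`-coaction corresponding to a `G`-grading. -/
def coaction [IsScalarTower k A A] [SMulCommClass k A A] (Γ : GroupGrading k A G) :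
    HopfCoaction k (MonoidAlgebra k G) A where
  coact := Γ.coactionMap
  coassoc := Γ.linearMap_ext fun g x hx => by
    simp [Γ.coactionMap_of_mem hx]
  counit := Γ.linearMap_ext fun g x hx => by
    simp [Γ.coactionMap_of_mem hx]
  map_mul := by
    intro x y
    have h : (LinearMap.mul k A).compr₂ Γ.coactionMap =
        (LinearMap.mul k (A ⊗[k] MonoidAlgebra k G)).compl₁₂ Γ.coactionMap Γ.coactionMap :=
      Γ.linearMap_ext fun g x hx => Γ.linearMap_ext fun g' y hy => by
        simp [Γ.coactionMap_of_mem hx, Γ.coactionMap_of_mem hy,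
          Γ.coactionMap_of_mem (Γ.mul_mem hx hy)]
    exact LinearMap.congr_fun (LinearMap.congr_fun h x) y

end GroupGrading

end QSym

end

/-!
An action of a Hopf algebra `H` with operators in `V` is scalar on each graded component, so `H`
acts on the component of degree `g` by a character `χ_g : H → k`
(`QSym.HopfAction.exists_character`), and `χ_{gh}` is the convolution product of `χ_g` and `χ_h`
whenever the components of degrees `g` and `h` have a nonzero product
(`QSym.HopfAction.character_mul`). Characters are invertible under convolution, by the antipode, so
the universal property of `G` turns `g ↦ χ_g` into a homomorphism from `G` to the group of
characters (`QSym.GroupGrading.IsUniversalGroup.exists_monoidHom`), realized here as a group of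
translation operators on `H` (`QSym.characterUnit`).

The translations of `H` are locally finite, as in every comodule
(`QSym.exists_fg_lTensor_mem`), so `H` is a union of finite-dimensional representations of `G`.
By the argument of Malcev's theorem, a finitely generated group without nontrivial finite quotients
acts trivially on each of these (`HasNoFiniteQuotient.map_end_eq_one`): the matrix entries lie in a
finitely generated ring, whose residue fields are finite and detect its nonzero elements. Hence
every `χ_g` is the counit and the action of `H` is trivial
(`QSym.HopfAction.act_eq_counit_smul`). The base field acting by scalars is therefore universal, and
every universal action has scalar cosupport.

Finally `V` contains a nonscalar operator: as `G` is not trivial, some nonzero component has degree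
other than `1`, while diagonal matrix units have degree `1`
(`QSym.GroupGrading.IsUniversalGroup.bot_lt_cosupp`).
-/

noncomputable section

/-! ### Finitely generated linear groups and finite quotients -/

instance Int.isJacobsonRing : IsJacobsonRing ℤ := by
  rw [isJacobsonRing_iff_prime_eq]
  intro P hP
  by_cases hP0 : P = ⊥
  · subst hP0
    refine le_antisymm (fun x hx => ?_) Ideal.le_jacobson
    rw [Ideal.mem_bot]
    by_contra hx0
    obtain ⟨p, hpx, hp⟩ := Nat.exists_infinite_primes (x.natAbs + 1)
    have hp' : Prime (p : ℤ) := Nat.prime_iff_prime_int.1 hp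
    have hmax : (Ideal.span {(p : ℤ)}).IsMaximal :=
      PrincipalIdealRing.isMaximal_of_irreducible hp'.irreducible
    have hmem : x ∈ Ideal.span {(p : ℤ)} := by
      rw [Ideal.jacobson, Submodule.mem_sInf] at hx
      exact hx _ ⟨bot_le, hmax⟩
    rw [Ideal.mem_span_singleton, Int.natCast_dvd] at hmem
    have := Nat.le_of_dvd (Int.natAbs_pos.2 hx0) hmem
    omega
  · have := hP.isMaximal hP0
    exact Ideal.jacobson_eq_self_of_isMaximal

/-- A field that is finitely generated as a ring is finite. -/
theorem finite_of_field_of_finiteType_int (F : Type*) [Field F] [alg : Algebra ℤ F]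
    [Algebra.FiniteType ℤ F] : Finite F := by
  obtain rfl : alg = Ring.toIntAlgebra F := Subsingleton.elim _ _
  have : Module.Finite ℤ F := finite_of_finite_type_of_isJacobsonRing ℤ F
  have hinj : ¬ Function.Injective (algebraMap ℤ F) := fun h =>
    Int.not_isField (isField_of_isIntegral_of_isField h (Field.toIsField F))
  rw [injective_iff_map_eq_zero] at hinj
  push Not at hinj
  obtain ⟨m, hm, hm0⟩ := hinj
  refine Module.finite_of_fg_torsion F fun {x} => ⟨⟨m, mem_nonZeroDivisors_of_ne_zero hm0⟩, ?_⟩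
  change m • x = 0
  rw [Algebra.smul_def, hm, zero_mul]

/-- A nonzero element of a reduced finitely generated commutative ring survives in some finite
residue field, since in a Jacobson ring the maximal ideals intersect in the nilradical. -/
theorem exists_ideal_finite_quotient_notMem {R : Type*} [CommRing R] [IsReduced R]
    [Algebra.FiniteType ℤ R] {x : R} (hx : x ≠ 0) :
    ∃ m : Ideal R, Finite (R ⧸ m) ∧ x ∉ m := by
  have : IsJacobsonRing R := isJacobsonRing_of_finiteType (A := ℤ)
  have hj : (⊥ : Ideal R).jacobson = ⊥ := by
    rw [← Ideal.radical_eq_jacobson]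
    exact nilradical_eq_bot_iff.2 inferInstance
  have hx' : x ∉ (⊥ : Ideal R).jacobson := by rwa [hj]
  rw [Ideal.jacobson, Submodule.mem_sInf] at hx'
  push Not at hx'
  obtain ⟨m, ⟨-, hm⟩, hxm⟩ := hx'
  refine ⟨m, ?_, hxm⟩
  let := Ideal.Quotient.field m
  have : Algebra.FiniteType ℤ (R ⧸ m) :=
    Algebra.FiniteType.of_surjective (Ideal.Quotient.mkₐ ℤ m) (Ideal.Quotient.mkₐ_surjective ℤ m)
  exact finite_of_field_of_finiteType_int (R ⧸ m)

/-- A group has no finite quotients other than the trivial one. -/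
def HasNoFiniteQuotient (G : Type*) [Group G] : Prop :=
  ∀ N : Subgroup G, N.Normal → Finite (G ⧸ N) → Subsingleton (G ⧸ N)

namespace HasNoFiniteQuotient

variable {G : Type*} [Group G]

theorem map_eq_one_of_finite (hG : HasNoFiniteQuotient G) {M : Type*} [Monoid M] [Finite M]
    (f : G →* M) (g : G) : f g = 1 := by
  have hfin : Finite (G ⧸ f.toHomUnits.ker) :=
    Finite.of_equiv _ (QuotientGroup.quotientKerEquivRange f.toHomUnits).symm.toEquiv
  have := QuotientGroup.subgroup_eq_top_of_subsingleton _ (hG _ inferInstance hfin)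
  have hg : g ∈ f.toHomUnits.ker := this ▸ Subgroup.mem_top g
  simpa using congrArg Units.val (MonoidHom.mem_ker.1 hg)

/-- Reduction modulo the maximal ideals of `R` lands in finite matrix monoids, where the image of
`G` is trivial, and these reductions together separate matrices. -/
theorem map_matrix_eq_one_of_finiteType (hG : HasNoFiniteQuotient G) {R : Type*} [CommRing R]
    [IsReduced R] [Algebra.FiniteType ℤ R] {ι : Type*} [Fintype ι] [DecidableEq ι]
    (f : G →* Matrix ι ι R) (g : G) : f g = 1 := by
  ext i j
  by_contra hij
  obtain ⟨m, hfin, hm⟩ := exists_ideal_finite_quotient_notMem (sub_ne_zero.2 hij)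
  have h := hG.map_eq_one_of_finite
    ((Ideal.Quotient.mk m).mapMatrix.toMonoidHom.comp f) g
  have hij' := congrFun (congrFun h i) j
  apply hm
  rw [← Ideal.Quotient.eq]
  simpa [Matrix.one_apply, apply_ite] using hij'

/-- The consequence of Malcev's theorem on finitely generated linear groups that is needed here: a
finitely generated group without nontrivial finite quotients has only trivial matrix
representations over a field. -/
theorem map_matrix_eq_one (hG : HasNoFiniteQuotient G) [Group.FG G] {K : Type*} [Field K]
    {ι : Type*} [Fintype ι] [DecidableEq ι] (f : G →* Matrix ι ι K) (g : G) : f g = 1 := by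
  -- The entries of a finite set of monoid generators generate a ring over which `f` is defined.
  obtain ⟨S, hS, hSfin⟩ := Monoid.fg_iff.1 (Group.fg_iff_monoid_fg.1 ‹Group.FG G›)
  let E : Set K := ⋃ s ∈ S, Set.range fun ij : ι × ι => f s ij.1 ij.2
  have hE : E.Finite := hSfin.biUnion fun s _ => Set.finite_range _
  let R : Subalgebra ℤ K := Algebra.adjoin ℤ E
  have : Algebra.FiniteType ℤ R :=
    R.fg_iff_finiteType.1 ⟨hE.toFinset, by rw [hE.coe_toFinset]⟩
  let incl : Matrix ι ι R →* Matrix ι ι K := R.val.toRingHom.mapMatrix.toMonoidHom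
  have hincl : Function.Injective incl := Matrix.map_injective Subtype.val_injective
  have hrange : ∀ x, f x ∈ MonoidHom.mrange incl := by
    have : (⊤ : Submonoid G) ≤ (MonoidHom.mrange incl).comap f := by
      rw [← hS, Submonoid.closure_le]
      intro s hs
      refine ⟨Matrix.of fun i j => ⟨f s i j, Algebra.subset_adjoin ?_⟩, rfl⟩
      exact Set.mem_biUnion hs ⟨(i, j), rfl⟩
    exact fun x => this (Submonoid.mem_top x)
  let e : Matrix ι ι R ≃* MonoidHom.mrange incl :=
    MulEquiv.ofBijective incl.mrangeRestrict
      ⟨fun _ _ h => hincl (congrArg Subtype.val h), incl.mrangeRestrict_surjective⟩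
  have h := hG.map_matrix_eq_one_of_finiteType
    (e.symm.toMonoidHom.comp (f.codRestrict _ hrange)) g
  have h' : f.codRestrict _ hrange g = e 1 := e.symm_apply_eq.1 h
  rw [map_one] at h'
  exact congrArg Subtype.val h'

theorem map_end_eq_one (hG : HasNoFiniteQuotient G) [Group.FG G] {K W : Type*} [Field K]
    [AddCommGroup W] [Module K W] [FiniteDimensional K W] (f : G →* Module.End K W) (g : G) :
    f g = 1 := by
  let e := LinearMap.toMatrixAlgEquiv (Module.finBasis K W)
  have h := hG.map_matrix_eq_one (e.toMulEquiv.toMonoidHom.comp f) g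
  exact e.injective (h.trans (map_one e).symm)

/-- The representation may be infinite-dimensional, provided the orbit of `x` spans a
finite-dimensional subspace. -/
theorem map_end_apply_eq_self (hG : HasNoFiniteQuotient G) [Group.FG G] {K M : Type*} [Field K]
    [AddCommGroup M] [Module K M] (f : G →* Module.End K M) (x : M)
    (hx : (Submodule.span K (Set.range fun g => f g x)).FG) (g : G) : f g x = x := by
  set W := Submodule.span K (Set.range fun g => f g x)
  have : FiniteDimensional K W := Module.Finite.iff_fg.2 hx
  have hW : ∀ g, ∀ y ∈ W, f g y ∈ W := by
    intro g
    refine Submodule.span_le (p := W.comap (f g)).2 ?_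
    rintro _ ⟨g', rfl⟩
    exact Submodule.subset_span ⟨g * g', by simp⟩
  let f' : G →* Module.End K W :=
    { toFun := fun g => (f g).restrict (hW g)
      map_one' := by ext; simp
      map_mul' := fun _ _ => by ext; simp }
  have hxW : x ∈ W := Submodule.subset_span ⟨1, by simp⟩
  have h := congrArg (fun l : Module.End K W => (l ⟨x, hxW⟩ : M)) (hG.map_end_eq_one f' g)
  exact h

end HasNoFiniteQuotient

theorem Group.IsFinitelyPresented.group_fg (G : Type*) [Group G]
    [h : Group.IsFinitelyPresented G] : Group.FG G := by
  obtain ⟨n, φ, hφ, -⟩ := h.out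
  exact Group.fg_of_surjective hφ

namespace QSym

/-! ### Characters of a Hopf algebra acting by translations -/

section Regular

variable (k : Type u) [Field k] (H : Type v) [Ring H] [HopfAlgebra k H]

/-- The coaction of a Hopf algebra on itself by comultiplication. Its operators
`dualOp (regularCoaction k H).coact l` are the translations `x ↦ l (x₍₂₎) x₍₁₎`. -/
def regularCoaction : HopfCoaction k H H where
  coact := Coalgebra.comul
  coassoc := Coalgebra.coassoc
  counit := by
    rw [Coalgebra.lTensor_counit_comp_comul]
    ext x
    simp
  map_mul := Bialgebra.comul_mul

variable {k H}

theorem counit_dualOp_comul (l : Module.Dual k H) (x : H) :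
    Coalgebra.counit (R := k) (dualOp (Coalgebra.comul (R := k) (A := H)) l x) = l x := by
  have h : ∀ t : H ⊗[k] H, Coalgebra.counit (R := k) (TensorProduct.rid k H (l.lTensor H t)) =
      l (TensorProduct.lid k H ((Coalgebra.counit (R := k) (A := H)).rTensor H t)) := by
    intro t
    induction t with
    | zero => simp
    | add s t hs ht => simp only [map_add, hs, ht]
    | tmul y z => simp [mul_comm]
  exact (h _).trans (by simp)

/-- The local finiteness of comodules: applying all linear functions to the right factor of a fixed
tensor `∑ a_i ⊗ h_i` gives elements of the span of the finitely many `a_i`. -/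
theorem exists_fg_lTensor_mem {A : Type a} [AddCommGroup A] [Module k A] (t : A ⊗[k] H) :
    ∃ W : Submodule k A, W.FG ∧
      ∀ l : Module.Dual k H, TensorProduct.rid k A (l.lTensor A t) ∈ W := by
  induction t with
  | zero => exact ⟨⊥, Submodule.fg_bot, fun l => by simp⟩
  | add s t hs ht =>
    obtain ⟨W₁, h₁, hs⟩ := hs
    obtain ⟨W₂, h₂, ht⟩ := ht
    refine ⟨W₁ ⊔ W₂, h₁.sup h₂, fun l => ?_⟩
    simp only [map_add]
    exact add_mem (Submodule.mem_sup_left (hs l)) (Submodule.mem_sup_right (ht l))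
  | tmul y z =>
    refine ⟨k ∙ y, Submodule.fg_span_singleton y, fun l => ?_⟩
    simpa using Submodule.smul_mem _ (l z) (Submodule.mem_span_singleton_self y)

/-- Translation by a character `χ` of `H`, as a unit of the algebra of all translations. The inverse
is translation by `χ ∘ S`, where `S` is the antipode. Using units of this algebra avoids a group
structure on the set of characters itself. -/
def characterUnit (χ : H →ₐ[k] k) : (regularCoaction k H).cosuppˣ where
  val := ⟨dualOp (regularCoaction k H).coact χ.toLinearMap, _, rfl⟩
  inv := ⟨dualOp (regularCoaction k H).coact (χ.toLinearMap ∘ₗ HopfAlgebra.antipode k), _, rfl⟩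
  val_inv := by
    have h : LinearMap.mul' k k ∘ₗ TensorProduct.map χ.toLinearMap
        (χ.toLinearMap ∘ₗ HopfAlgebra.antipode k) ∘ₗ Coalgebra.comul =
        Coalgebra.counit (R := k) (A := H) := by
      have h' : LinearMap.mul' k k ∘ₗ TensorProduct.map χ.toLinearMap
          (χ.toLinearMap ∘ₗ HopfAlgebra.antipode k) =
          χ.toLinearMap ∘ₗ LinearMap.mul' k H ∘ₗ (HopfAlgebra.antipode k).lTensor H := by
        ext; simp
      rw [← LinearMap.comp_assoc, h', LinearMap.comp_assoc, LinearMap.comp_assoc,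
        HopfAlgebra.mul_antipode_lTensor_comul]
      ext; simp
    refine Subtype.ext ((HopfCoaction.dualOp_mul _ _ _).trans ?_)
    rw [h]
    exact (regularCoaction k H).counit
  inv_val := by
    have h : LinearMap.mul' k k ∘ₗ TensorProduct.map
        (χ.toLinearMap ∘ₗ HopfAlgebra.antipode k) χ.toLinearMap ∘ₗ Coalgebra.comul =
        Coalgebra.counit (R := k) (A := H) := by
      have h' : LinearMap.mul' k k ∘ₗ TensorProduct.map
          (χ.toLinearMap ∘ₗ HopfAlgebra.antipode k) χ.toLinearMap =
          χ.toLinearMap ∘ₗ LinearMap.mul' k H ∘ₗ (HopfAlgebra.antipode k).rTensor H := by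
        ext; simp
      rw [← LinearMap.comp_assoc, h', LinearMap.comp_assoc, LinearMap.comp_assoc,
        HopfAlgebra.mul_antipode_rTensor_comul]
      ext; simp
    refine Subtype.ext ((HopfCoaction.dualOp_mul _ _ _).trans ?_)
    rw [h]
    exact (regularCoaction k H).counit

/-- The hypothesis says that `χ` is the convolution product of `χ₁` and `χ₂`. -/
theorem characterUnit_mul {χ₁ χ₂ χ : H →ₐ[k] k}
    (h : ∀ x, χ x = LinearMap.mul' k k
      (TensorProduct.map χ₁.toLinearMap χ₂.toLinearMap (Coalgebra.comul x))) :
    characterUnit χ₁ * characterUnit χ₂ = characterUnit χ := by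
  refine Units.ext (Subtype.ext ((HopfCoaction.dualOp_mul _ _ _).trans ?_))
  exact congrArg (dualOp (regularCoaction k H).coact) (LinearMap.ext fun x => (h x).symm)

/-- A character through which a finitely generated group without nontrivial finite quotients acts
on `H` by translations is trivial, because this action is locally finite and hence trivial. -/
theorem apply_eq_counit_of_eq_characterUnit {G : Type*} [Group G] [Group.FG G]
    (hG : HasNoFiniteQuotient G) (φ : G →* (regularCoaction k H).cosuppˣ) (g : G)
    {χ : H →ₐ[k] k} (hχ : φ g = characterUnit χ) (x : H) :
    χ x = Coalgebra.counit (R := k) x := by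
  let f : G →* Module.End k H :=
    ((regularCoaction k H).cosupp.val : _ →* Module.End k H).comp ((Units.coeHom _).comp φ)
  obtain ⟨W, hW, hmem⟩ := exists_fg_lTensor_mem (k := k) (Coalgebra.comul (R := k) x)
  have hle : Submodule.span k (Set.range fun g => f g x) ≤ W := by
    rw [Submodule.span_le]
    rintro _ ⟨g', rfl⟩
    obtain ⟨l, hl⟩ := (φ g').val.2
    have : f g' x = dualOp (regularCoaction k H).coact l x := by rw [hl]; rfl
    simp only [this]
    exact hmem l
  have : FiniteDimensional k W := Module.Finite.iff_fg.2 hW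
  have h1 := hG.map_end_apply_eq_self f x (Module.Finite.iff_fg.1
    (Submodule.finiteDimensional_of_le hle)) g
  have h2 : f g x = dualOp (Coalgebra.comul (R := k)) χ.toLinearMap x := by
    change (((φ g).val : Module.End k H)) x = _
    rw [hχ]; rfl
  rw [h2] at h1
  exact (counit_dualOp_comul χ.toLinearMap x).symm.trans (congrArg _ h1)

end Regular

/-! ### The universal group of a grading -/

namespace GroupGrading

variable {k : Type u} [Field k] {A : Type a} [NonUnitalNonAssocRing A] [Module k A]
  {G : Type v} [Group G]

theorem eq_of_mem_of_mem (Γ : GroupGrading k A G) {g h : G} {x : A} (hg : x ∈ Γ.component g)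
    (hh : x ∈ Γ.component h) (hx : x ≠ 0) : g = h := by
  by_contra hne
  exact hx (Submodule.disjoint_def.1 (Γ.indep.pairwiseDisjoint hne) x hg hh)

open Classical in
/-- Given a function `F : G → K` that is multiplicative on the pairs of degrees whose components
have nonzero products, relabel a `G`-grading by `g ↦ (g, F g)`, as a grading by any subgroup
`p : L → G × K` containing the graph of `F`. The components off the graph are zero. The first
coordinate makes the relabelling injective even if `F` is not. -/
def ofGraph (Γ : GroupGrading k A G) {K : Type b} [Group K] (F : G → K)
    (hF : ∀ g h : G, ∀ x ∈ Γ.component g, ∀ y ∈ Γ.component h, x * y ≠ 0 →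
      F (g * h) = F g * F h)
    {L : Type w} [Group L] (p : L →* G × K) (hp : Function.Injective p)
    (hL : ∀ g, (g, F g) ∈ p.range) : GroupGrading k A L where
  component q := if (p q).2 = F (p q).1 then Γ.component (p q).1 else ⊥
  indep := by
    intro q
    beta_reduce
    split_ifs with hq
    · refine (Γ.indep (p q).1).mono_right (iSup₂_le fun r hr => ?_)
      split_ifs with hr'
      · refine le_iSup₂_of_le (p r).1 (fun h => hr (hp (Prod.ext h ?_))) le_rfl
        rw [hr', hq, h]
      · exact bot_le
    · exact disjoint_bot_left
  iSup_eq_top := by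
    rw [eq_top_iff, ← Γ.iSup_eq_top]
    refine iSup_le fun g => ?_
    obtain ⟨q, hq⟩ := hL g
    refine le_iSup_of_le q ?_
    simp [hq]
  mul_mem := by
    intro q r x y hx hy
    by_cases hxy : x * y = 0
    · rw [hxy]; exact zero_mem _
    split_ifs at hx hy with hq hr
    · have hqr : (p (q * r)).2 = F (p (q * r)).1 := by
        simp [hq, hr, hF _ _ _ hx _ hy hxy]
      rw [if_pos hqr]
      simpa using Γ.mul_mem hx hy
    all_goals simp_all

theorem ofGraph_component (Γ : GroupGrading k A G) {K : Type b} [Group K] (F : G → K)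
    (hF : ∀ g h : G, ∀ x ∈ Γ.component g, ∀ y ∈ Γ.component h, x * y ≠ 0 →
      F (g * h) = F g * F h)
    {L : Type w} [Group L] (p : L →* G × K) (hp : Function.Injective p)
    (hL : ∀ g, (g, F g) ∈ p.range) {q : L} {g : G} (hq : p q = (g, F g)) :
    (Γ.ofGraph F hF p hp hL).component q = Γ.component g := by
  simp [ofGraph, hq]

/-- The universal group maps to groups `K` in an arbitrary universe, along labellings of the
components that need not be injective but respect all nonzero products. -/
theorem IsUniversalGroup.exists_monoidHom {G₀ : Type v₀} [Group G₀] {Γ : GroupGrading k A G₀}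
    {ΓG : GroupGrading k A G} {κ : Γ.supp → G} (hU : Γ.IsUniversalGroup ΓG κ)
    {K : Type b} [Group K] (F : G → K)
    (hF : ∀ g h : G, ∀ x ∈ ΓG.component g, ∀ y ∈ ΓG.component h, x * y ≠ 0 →
      F (g * h) = F g * F h) :
    ∃ φ : G →* K, ∀ s, φ (κ s) = F (κ s) := by
  -- The subgroup of `G × K` generated by the graph of `F` is a quotient of the free group on `G`,
  -- so it has a copy in the universe of `G`, where the universal property applies.
  let L : Subgroup (G × K) := (FreeGroup.lift fun g => (g, F g)).range
  have : Small.{v} L := small_range (FreeGroup.lift fun g => (g, F g))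
  let p : Shrink.{v} L →* G × K := L.subtype.comp (Shrink.mulEquiv (α := L)).toMonoidHom
  have hp : Function.Injective p :=
    Subtype.val_injective.comp (Shrink.mulEquiv (α := L)).injective
  have hL : ∀ g, (g, F g) ∈ p.range := by
    intro g
    have hg : (g, F g) ∈ L := ⟨FreeGroup.of g, by simp⟩
    exact ⟨(Shrink.mulEquiv (α := L)).symm ⟨_, hg⟩, by simp [p]⟩
  choose q hq using id hL
  obtain ⟨φ, hφ, -⟩ := hU.2 _ (ΓG.ofGraph F hF p hp hL) (fun s => q (κ s))
    fun s => by exact (hU.1 s).trans (ofGraph_component _ _ _ _ _ _ (hq _)).symm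
  exact ⟨(MonoidHom.snd G K).comp (p.comp φ), fun s => by simp [hφ, hq]⟩

theorem dualOp_coactionMap (Γ : GroupGrading k A G) (l : Module.Dual k (MonoidAlgebra k G))
    {g : G} {x : A} (hx : x ∈ Γ.component g) :
    dualOp Γ.coactionMap l x = l (MonoidAlgebra.single g 1) • x := by
  simp [dualOp, Γ.coactionMap_of_mem hx]

end GroupGrading

/-! ### Actions by operators that are scalar on graded components -/

section Action

variable {k : Type u} [Field k] {A : Type a} [NonUnitalNonAssocRing A] [Module k A]
  [IsScalarTower k A A] [SMulCommClass k A A] {G : Type v} [Group G]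
  {H : Type w} [Ring H] [HopfAlgebra k H]

/-- If the operators of an action lie in the cosupport of a grading, then `H` acts on each component
by a character. -/
theorem HopfAction.exists_character (Γ : GroupGrading k A G) (ψ : HopfAction k H A)
    (hψ : ψ.cosupp ≤ Γ.coaction.cosupp) (g : G) :
    ∃ χ : H →ₐ[k] k, ∀ h, ∀ x ∈ Γ.component g, ψ.act h x = χ h • x := by
  -- On a zero component any character will do.
  by_cases hg : Γ.component g = ⊥
  · refine ⟨Bialgebra.counitAlgHom k H, fun h x hx => ?_⟩
    rw [hg, Submodule.mem_bot] at hx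
    simp [hx]
  obtain ⟨x₀, hx₀, hx₀'⟩ := (Submodule.ne_bot_iff _).1 hg
  have hc : ∀ h, ∃ c : k, ∀ x ∈ Γ.component g, ψ.act h x = c • x := by
    intro h
    obtain ⟨l, hl⟩ := hψ (⟨h, rfl⟩ : ψ.act h ∈ ψ.cosupp)
    exact ⟨_, fun x hx => by rw [← hl]; exact Γ.dualOp_coactionMap l hx⟩
  choose c hc using hc
  have hinj : Function.Injective fun r : k => r • x₀ := smul_left_injective k hx₀'
  refine ⟨AlgHom.ofLinearMap ⟨⟨c, fun h h' => hinj ?_⟩, fun r h => hinj ?_⟩ (hinj ?_)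
    fun h h' => hinj ?_, hc⟩
  · simp [add_smul, ← hc _ _ hx₀]
  · change c (r • h) • x₀ = (r • c h) • x₀
    rw [← hc _ _ hx₀, map_smul, LinearMap.smul_apply, hc _ _ hx₀, smul_assoc]
  · simp [← hc _ _ hx₀]
  · change c (h * h') • x₀ = (c h * c h') • x₀
    rw [← hc _ _ hx₀, map_mul, Module.End.mul_apply, hc h' _ hx₀, map_smul, hc h _ hx₀, smul_smul,
      mul_comm]

/-- The character on a nonzero product is the convolution product of the characters on the
factors. -/
theorem HopfAction.character_mul (ψ : HopfAction k H A) {x y : A} (hxy : x * y ≠ 0)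
    {χ₁ χ₂ χ : H →ₐ[k] k} (h₁ : ∀ h, ψ.act h x = χ₁ h • x) (h₂ : ∀ h, ψ.act h y = χ₂ h • y)
    (h₃ : ∀ h, ψ.act h (x * y) = χ h • (x * y)) (h : H) :
    χ h = LinearMap.mul' k k
      (TensorProduct.map χ₁.toLinearMap χ₂.toLinearMap (Coalgebra.comul h)) := by
  refine smul_left_injective k hxy ?_
  beta_reduce
  rw [← h₃, ψ.act_mul]
  induction Coalgebra.comul (R := k) h with
  | zero => simp
  | add s t hs ht => simp only [map_add, hs, ht, add_smul]
  | tmul a b => simp [h₁, h₂, smul_mul_assoc, smul_smul, mul_comm]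

/-- Every action whose operators are scalar on the components is trivial, if the universal group is
finitely generated and has no nontrivial finite quotients. -/
theorem HopfAction.act_eq_counit_smul [Group.FG G] (hG : HasNoFiniteQuotient G)
    {G₀ : Type v₀} [Group G₀] {Γ : GroupGrading k A G₀} {ΓG : GroupGrading k A G}
    {κ : Γ.supp → G} (hU : Γ.IsUniversalGroup ΓG κ) (ψ : HopfAction k H A)
    (hψ : ψ.cosupp ≤ ΓG.coaction.cosupp) (h : H) :
    ψ.act h = algebraMap k (Module.End k A) (Coalgebra.counit h) := by
  choose χ hχ using ψ.exists_character ΓG hψ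
  obtain ⟨φ, hφ⟩ := hU.exists_monoidHom (fun g => characterUnit (χ g))
    fun g g' x hx y hy hxy => (characterUnit_mul (ψ.character_mul hxy (hχ g · x hx)
      (hχ g' · y hy) (hχ (g * g') · _ (ΓG.mul_mem hx hy)))).symm
  refine Γ.linearMap_ext fun g x hx => ?_
  by_cases hg : Γ.component g = ⊥
  · rw [hg, Submodule.mem_bot] at hx
    simp [hx]
  · have hx' : x ∈ ΓG.component (κ ⟨g, hg⟩) := hU.1 ⟨g, hg⟩ ▸ hx
    rw [hχ _ h x hx', apply_eq_counit_of_eq_characterUnit hG φ _ (hφ ⟨g, hg⟩),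
      Module.algebraMap_end_apply]

theorem HopfAction.cosupp_eq_bot {ψ : HopfAction k H A}
    (hψ : ∀ h, ψ.act h = algebraMap k (Module.End k A) (Coalgebra.counit h)) :
    ψ.cosupp = ⊥ := by
  rw [eq_bot_iff]
  rintro _ ⟨h, rfl⟩
  exact Algebra.mem_bot.2 ⟨_, (hψ h).symm⟩

variable (k A) in
/-- The base field, as a Hopf algebra, acting by scalars. -/
def scalarAction : HopfAction k k A where
  act := Algebra.ofId k (Module.End k A)
  act_mul := fun h x y => by
    simp [Algebra.ofId_apply, Module.algebraMap_end_apply]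

theorem scalarAction_isUniversal {V : Subalgebra k (Module.End k A)}
    (hV : ∀ (H : Type w) [Ring H] [HopfAlgebra k H] (ψ : HopfAction k H A), ψ.cosupp ≤ V →
      ∀ h, ψ.act h = algebraMap k (Module.End k A) (Coalgebra.counit h)) :
    HopfAction.IsUniversal.{u, u, w} V (scalarAction k A) := by
  refine ⟨?_, fun H' _ _ ψ' hψ' => ⟨Bialgebra.counitBialgHom k H', fun h x => ?_,
    fun _ _ => Subsingleton.elim _ _⟩⟩
  · rw [(scalarAction k A).cosupp_eq_bot fun _ => rfl]
    exact bot_le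
  · rw [hV H' ψ' hψ']
    rfl

end Action

/-! ### The cosupport of the grading is not scalar -/

namespace GroupGrading

variable {k : Type u} [Field k] {G : Type v} [Group G]

/-- Otherwise both the identity and the trivial endomorphism of `G` are compatible with `κ`. -/
theorem IsUniversalGroup.exists_ne_one {A : Type a} [NonUnitalNonAssocRing A] [Module k A]
    [Nontrivial G] {G₀ : Type v₀} [Group G₀]
    {Γ : GroupGrading k A G₀} {ΓG : GroupGrading k A G}
    {κ : Γ.supp → G} (hU : Γ.IsUniversalGroup ΓG κ) : ∃ s, κ s ≠ 1 := by
  by_contra! h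
  obtain ⟨φ, -, hφ⟩ := hU.2 G ΓG κ hU.1
  have h1 : MonoidHom.id G = 1 :=
    (hφ _ fun s => rfl).trans (hφ 1 fun s => by simp [h s]).symm
  obtain ⟨g, hg⟩ := exists_ne (1 : G)
  exact hg (DFunLike.congr_fun h1 g)

theorem IsUniversalGroup.bot_lt_cosupp {n : ℕ} [Nontrivial G]
    {G₀ : Type v₀} [Group G₀] {Γ : GroupGrading k (Matrix (Fin n) (Fin n) k) G₀}
    (hΓ : Γ.IsElementary) {ΓG : GroupGrading k (Matrix (Fin n) (Fin n) k) G}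
    {κ : Γ.supp → G} (hU : Γ.IsUniversalGroup ΓG κ) : ⊥ < ΓG.coaction.cosupp := by
  refine bot_lt_iff_ne_bot.2 fun hbot => ?_
  obtain ⟨s, hs⟩ := hU.exists_ne_one
  obtain ⟨x, hx, hx0⟩ := (Submodule.ne_bot_iff _).1 s.2
  obtain ⟨i⟩ : Nonempty (Fin n) := by
    by_contra h
    rw [not_nonempty_iff] at h
    exact hx0 (Subsingleton.elim _ _)
  -- The diagonal matrix unit `e` has degree `1`, while `x` has degree `κ s ≠ 1`, so reading off the
  -- coefficient of `1` gives an operator in the cosupport that fixes `e` and kills `x`.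
  set e : Matrix (Fin n) (Fin n) k := Matrix.single i i 1
  have he0 : e ≠ 0 := fun h => by simpa [e] using congrFun (congrFun h i) i
  have hee : e * e = e := by simp [e]
  have he : e ∈ Γ.component 1 := by
    obtain ⟨g, hg⟩ := hΓ
    simpa using hg i i
  have he' : e ∈ ΓG.component (κ ⟨1, fun h => he0 (by simpa [h] using he)⟩) := hU.1 _ ▸ he
  have hκ := ΓG.eq_of_mem_of_mem he' (hee ▸ ΓG.mul_mem he' he') he0
  rw [left_eq_mul] at hκ
  rw [hκ] at he'
  let l : Module.Dual k (MonoidAlgebra k G) :=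
    Finsupp.lapply 1 ∘ₗ (MonoidAlgebra.coeffLinearEquiv k).toLinearMap
  have hl : dualOp ΓG.coactionMap l ∈ ΓG.coaction.cosupp := ⟨l, rfl⟩
  rw [hbot, Algebra.mem_bot] at hl
  obtain ⟨c, hc⟩ := hl
  have hce := LinearMap.congr_fun hc e
  have hcx := LinearMap.congr_fun hc x
  rw [dualOp_coactionMap _ _ he'] at hce
  rw [dualOp_coactionMap _ _ (hU.1 s ▸ hx)] at hcx
  have h1 : l (MonoidAlgebra.single 1 1) = 1 := by simp [l]
  have h2 : l (MonoidAlgebra.single (κ s) 1) = 0 := by simp [l, hs]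
  rw [h1, Module.algebraMap_end_apply] at hce
  rw [h2, Module.algebraMap_end_apply, zero_smul, smul_eq_zero_iff_left hx0] at hcx
  rw [hcx, zero_smul, one_smul] at hce
  exact he0 hce.symm

end GroupGrading

end QSym

end

theorem mainTheorem2 (k : Type u) [Field k]
    (G : Type v) [Group G] [Infinite G] [Group.IsFinitelyPresented G]
    (hG : ∀ N : Subgroup G, N.Normal → Finite (G ⧸ N) → Subsingleton (G ⧸ N))
    (n : ℕ) (G₀ : Type v₀) [Group G₀]
    (Γ : QSym.GroupGrading k (Matrix (Fin n) (Fin n) k) G₀) (hΓ : Γ.IsElementary)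
    (ΓG : QSym.GroupGrading k (Matrix (Fin n) (Fin n) k) G) (κ : Γ.supp → G)
    (hU : Γ.IsUniversalGroup ΓG κ)
    (V : Subalgebra k (Module.End k (Matrix (Fin n) (Fin n) k)))
    (hV : V = ΓG.coaction.cosupp) :
    (∃ (H : Type u) (_ : Ring H) (_ : HopfAlgebra k H)
      (ψ : QSym.HopfAction k H (Matrix (Fin n) (Fin n) k)),
        QSym.HopfAction.IsUniversal.{u, u, w} V ψ) ∧
    (∀ (H : Type v₁) [Ring H] [HopfAlgebra k H]
      (ψ : QSym.HopfAction k H (Matrix (Fin n) (Fin n) k)),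
        QSym.HopfAction.IsUniversal.{u, v₁, w} V ψ → ψ.cosupp = ⊥) ∧
    (⊥ : Subalgebra k (Module.End k (Matrix (Fin n) (Fin n) k))) < V := by
  subst hV
  have := Group.IsFinitelyPresented.group_fg G
  refine ⟨⟨k, _, _, QSym.scalarAction k _, QSym.scalarAction_isUniversal fun H _ _ ψ hψ =>
    ψ.act_eq_counit_smul hG hU hψ⟩, fun H _ _ ψ hψ => ?_, hU.bot_lt_cosupp hΓ⟩
  exact ψ.cosupp_eq_bot (ψ.act_eq_counit_smul hG hU hψ.1)
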